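/- Let $k$ be a field. Modules over a finite-dimensional $k$-algebra are finite-dimensional left modules. A *basic algebra* is a finite-dimensional $k$-algebra of the form $kQ/I$, where $Q$ is a finite quiver, $kQ$ is its path algebra, and $I$ is a two-sided ideal generated by a set of relations, a relation being a $k$-linear combination of paths of length at least two which all have the same starting point and the same end point. For a finite-dimensional $k$-algebra $A$, a *generator-cogenerator* of $A$ is an $A$-module $Z$ such that $A\oplus A^*\in\operatorname{add}(Z)$, where $A^*=\operatorname{Hom}_k(A_A,k)$ and $\operatorname{add}(Z)$ is the class of all modules isomorphic to direct summands of finite direct sums of copies of $Z$. The global dimension $\operatorname{gldim}(E)$ of a finite-dimensional algebra $E$ is the supremum of the projective dimensions of its modules, and the *representation dimension* of $A$ is $$\operatorname{repdim}(A)=\min\{\operatorname{gldim}(\operatorname{End}_A(Z)) \mid Z \text{ a generator-cogenerator of } A\}.$$ **Proposition.** Let $A$ be a basic algebra, and let $P$ be an indecomposable projective-injective $A$-module. Let $\operatorname{soc}(P)$ be the sum of the simple submodules of $P$, regarded as an ideal of $A$ by means of the embeddings $P\hookrightarrow A$ of left $A$-modules (that is, as the two-sided ideal generated by the images of $\operatorname{soc}(P)$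 under these embeddings; whenever the image of $\operatorname{soc}(P)$ under one embedding is a two-sided ideal of $A$, the ideal is that image). Define $B=A/\operatorname{soc}(P)$. If $\operatorname{repdim}(B)\le 3$, then $\operatorname{repdim}(A)\le 3$. -/

import Mathlib

universe u v w

noncomputable section

open CategoryTheory

namespace RepDim

/-! ### Path algebras of quivers and basic algebras -/

/-- A path in a quiver, together with its starting point and its end point. -/
structure QPath (V : Type v) [Quiver.{w} V] where
  /-- the starting point -/
  src : V
  /-- the end point -/
  tgt : V
  /-- the path itself -/
  path : Quiver.Path src tgt

/-- The path algebra `kQ`: the vector space with basis the set of all paths of the quiver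
(including the paths of length zero at the vertices). -/
def PathAlgebra (k : Type u) [Field k] (V : Type v) [Quiver.{w} V] : Type (max u v w) :=
  QPath V →₀ k

namespace PathAlgebra

variable (k : Type u) [Field k] (V : Type v) [Quiver.{w} V]

instance : AddCommGroup (PathAlgebra k V) := inferInstanceAs (AddCommGroup (QPath V →₀ k))

instance : Module k (PathAlgebra k V) := inferInstanceAs (Module k (QPath V →₀ k))

variable {V}

/-- The basis element of the path algebra given by a path. -/
def ofPath (p : QPath V) : PathAlgebra k V := Finsupp.single p (1 : k)

open Classical in
/-- The product `p q` of two paths: the concatenation "first `q`, then `p`" if the end point of `q`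
is the starting point of `p`, and zero otherwise. -/
def pathMul (p q : QPath V) : PathAlgebra k V :=
  if h : q.tgt = p.src then ofPath k ⟨q.src, p.tgt, q.path.comp (p.path.cast h.symm rfl)⟩ else 0

variable (V)

/-- The multiplication of the path algebra, the bilinear extension of the product of paths. -/
def mulHom : PathAlgebra k V →ₗ[k] PathAlgebra k V →ₗ[k] PathAlgebra k V :=
  Finsupp.linearCombination k fun p : QPath V =>
    (Finsupp.linearCombination k fun q : QPath V => pathMul k p q :
      (QPath V →₀ k) →ₗ[k] PathAlgebra k V)

instance : Mul (PathAlgebra k V) := ⟨fun f g => mulHom k V f g⟩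

/-- The unit of the path algebra: the sum of the paths of length zero. -/
instance [Fintype V] : One (PathAlgebra k V) :=
  ⟨∑ a : V, ofPath k ⟨a, a, Quiver.Path.nil⟩⟩

variable {k V}

theorem mul_def (f g : PathAlgebra k V) : f * g = mulHom k V f g := rfl

theorem ofPath_mul_ofPath (p q : QPath V) : ofPath k p * ofPath k q = pathMul k p q := by
  rw [mul_def, mulHom, ofPath, ofPath]
  erw [Finsupp.linearCombination_single, one_smul, Finsupp.linearCombination_single, one_smul]

@[elab_as_elim]
theorem induction_on {motive : PathAlgebra k V → Prop} (f : PathAlgebra k V)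
    (zero : motive 0) (add : ∀ f g, motive f → motive g → motive (f + g))
    (smul_ofPath : ∀ (c : k) (p : QPath V), motive (c • ofPath k p)) : motive f := by
  refine Finsupp.induction_linear (motive := motive) f zero add fun p c => ?_
  have := smul_ofPath c p
  have h : c • ofPath k p = (Finsupp.single p c : QPath V →₀ k) := by
    simp only [ofPath]
    exact (Finsupp.smul_single c p 1).trans (by simp)
  rwa [h] at this

theorem add_mul' (f g h : PathAlgebra k V) : (f + g) * h = f * h + g * h := by
  simp [mul_def]

theorem mul_add' (f g h : PathAlgebra k V) : f * (g + h) = f * g + f * h := by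
  simp [mul_def]

theorem zero_mul' (f : PathAlgebra k V) : 0 * f = 0 := by simp [mul_def]

theorem mul_zero' (f : PathAlgebra k V) : f * 0 = 0 := by simp [mul_def]

theorem smul_mul' (c : k) (f g : PathAlgebra k V) : (c • f) * g = c • (f * g) := by
  simp [mul_def]

theorem mul_smul' (c : k) (f g : PathAlgebra k V) : f * (c • g) = c • (f * g) := by
  simp [mul_def]

theorem ofPath_assoc (p q r : QPath V) :
    ofPath k p * ofPath k q * ofPath k r = ofPath k p * (ofPath k q * ofPath k r) := by
  obtain ⟨p₀, p₁, p⟩ := p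
  obtain ⟨q₀, q₁, q⟩ := q
  obtain ⟨r₀, r₁, r⟩ := r
  simp only [ofPath_mul_ofPath]
  by_cases h : q₁ = p₀
  · subst h
    by_cases h' : r₁ = q₀
    · subst h'
      simp [pathMul, ofPath_mul_ofPath]
    · simp [pathMul, ofPath_mul_ofPath, h', mul_zero']
  · by_cases h' : r₁ = q₀
    · subst h'
      simp [pathMul, ofPath_mul_ofPath, h, zero_mul']
    · simp [pathMul, h, h', zero_mul', mul_zero']

theorem mul_assoc' (f g h : PathAlgebra k V) : f * g * h = f * (g * h) := by
  induction f using induction_on with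
  | zero => simp only [zero_mul']
  | add f₁ f₂ h₁ h₂ => simp only [add_mul', h₁, h₂]
  | smul_ofPath c p =>
    simp only [smul_mul']
    congr 1
    induction g using induction_on with
    | zero => simp only [zero_mul', mul_zero']
    | add f₁ f₂ h₁ h₂ => simp only [add_mul', mul_add', h₁, h₂]
    | smul_ofPath d q =>
      simp only [smul_mul', mul_smul']
      congr 1
      induction h using induction_on with
      | zero => simp only [mul_zero']
      | add f₁ f₂ h₁ h₂ => simp only [mul_add', h₁, h₂]
      | smul_ofPath e r => simp only [mul_smul', ofPath_assoc]

theorem one_mul' [Fintype V] (f : PathAlgebra k V) : 1 * f = f := by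
  classical
  induction f using induction_on with
  | zero => exact mul_zero' _
  | add f g hf hg => rw [mul_add', hf, hg]
  | smul_ofPath c p =>
    rw [mul_smul']
    congr 1
    change mulHom k V (∑ a : V, ofPath k ⟨a, a, Quiver.Path.nil⟩) _ = _
    rw [map_sum, LinearMap.sum_apply, Finset.sum_eq_single p.tgt]
    · rw [← mul_def, ofPath_mul_ofPath]
      simp [pathMul]
    · intro a _ ha
      rw [← mul_def, ofPath_mul_ofPath]
      simp [pathMul, ha.symm]
    · simp

theorem mul_one' [Fintype V] (f : PathAlgebra k V) : f * 1 = f := by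
  classical
  induction f using induction_on with
  | zero => exact zero_mul' _
  | add f g hf hg => rw [add_mul', hf, hg]
  | smul_ofPath c p =>
    rw [smul_mul']
    congr 1
    change mulHom k V _ (∑ a : V, ofPath k ⟨a, a, Quiver.Path.nil⟩) = _
    rw [map_sum, Finset.sum_eq_single p.src]
    · rw [← mul_def, ofPath_mul_ofPath]
      simp [pathMul]
    · intro a _ ha
      rw [← mul_def, ofPath_mul_ofPath]
      simp [pathMul, ha]
    · simp

instance [Fintype V] : Ring (PathAlgebra k V) where
  __ := (inferInstance : AddCommGroup (PathAlgebra k V))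
  __ := (inferInstance : Mul (PathAlgebra k V))
  __ := (inferInstance : One (PathAlgebra k V))
  left_distrib := mul_add'
  right_distrib := add_mul'
  zero_mul := zero_mul'
  mul_zero := mul_zero'
  mul_assoc := mul_assoc'
  one_mul := one_mul'
  mul_one := mul_one'

instance [Fintype V] : Algebra k (PathAlgebra k V) :=
  Algebra.ofModule smul_mul' mul_smul'

/-- The coefficient of a path in an element of the path algebra. -/
def coeff (f : PathAlgebra k V) (p : QPath V) : k := DFunLike.coe (F := QPath V →₀ k) f p

/-- A relation for a quiver: a linear combination of paths of length at least two which all have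
the same starting point and the same end point. -/
def IsRelation (r : PathAlgebra k V) : Prop :=
  ∃ a b : V, ∀ p : QPath V, r.coeff p ≠ 0 →
    p.src = a ∧ p.tgt = b ∧ 2 ≤ p.path.length

end PathAlgebra

/-- A basic algebra over `k`: a finite-dimensional algebra (isomorphic to an algebra) of the form
`kQ/I`, where `Q` is a finite quiver and `I` is the two-sided ideal generated by a set of
relations. -/
def IsBasicAlgebra (k : Type u) [Field k] (A : Type v) [Ring A] [Algebra k A] : Prop :=
  FiniteDimensional k A ∧
    ∃ (V : Type) (_ : Fintype V) (_ : Quiver.{0} V) (_ : ∀ a b : V, Finite (a ⟶ b))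
      (ρ : Set (PathAlgebra k V)), (∀ r ∈ ρ, PathAlgebra.IsRelation r) ∧
        Nonempty (A ≃ₐ[k] (TwoSidedIdeal.span ρ).ringCon.Quotient)

/-! ### Indecomposable modules and socles -/

/-- A module is indecomposable if it is nonzero and is not the direct sum of two nonzero
submodules. -/
def IsIndecomposable (A : Type u) [Ring A] (P : Type v) [AddCommGroup P] [Module A P] : Prop :=
  Nontrivial P ∧ ∀ U W : Submodule A P, IsCompl U W → U = ⊥ ∨ W = ⊥

/-- The socle of a module: the sum of its simple submodules. -/
def socle (A : Type u) [Ring A] (P : Type v) [AddCommGroup P] [Module A P] : Submodule A P :=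
  sSup {S : Submodule A P | IsSimpleModule A S}

/-- The socle of an `A`-module `P`, regarded as a two-sided ideal of `A`: the two-sided ideal
generated by the copies `ι (soc P)` of `soc P` in `A`, for the embeddings `ι : P → A` of left
`A`-modules. For injective `P` it is generated by any one of these copies
(`socleIdeal_eq_span`), so it is equal to that copy as soon as the copy is a two-sided
ideal (`mem_socleIdeal_iff`). -/
def socleIdeal (A : Type u) [Ring A] (P : Type v) [AddCommGroup P] [Module A P] :
    TwoSidedIdeal A :=
  TwoSidedIdeal.span
    {a | ∃ ι : P →ₗ[A] A, Function.Injective ι ∧ ∃ y ∈ socle A P, ι y = a}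

theorem socleIdeal_eq_span {A : Type u} [Ring A] {P : Type u} [AddCommGroup P] [Module A P]
    [Module.Injective A P] (ι : P →ₗ[A] A) (hι : Function.Injective ι) :
    socleIdeal A P = TwoSidedIdeal.span (ι '' (socle A P : Set P)) := by
  apply le_antisymm
  · refine TwoSidedIdeal.span_le.2 ?_
    rintro _ ⟨κ, -, y, hy, rfl⟩
    obtain ⟨h, hh⟩ := Module.Injective.out ι hι LinearMap.id
    have h1 : κ y = ι y * κ (h 1) := by
      have h2 : h (ι y * 1) = ι y • h 1 := by rw [← smul_eq_mul, map_smul]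
      rw [mul_one, hh, LinearMap.id_apply] at h2
      conv_lhs => rw [h2, map_smul, smul_eq_mul]
    rw [SetLike.mem_coe, h1]
    exact TwoSidedIdeal.mul_mem_right _ _ _ (TwoSidedIdeal.subset_span ⟨y, hy, rfl⟩)
  · refine TwoSidedIdeal.span_mono ?_
    rintro _ ⟨y, hy, rfl⟩
    exact ⟨ι, hι, y, hy, rfl⟩

theorem mem_socleIdeal_iff {A : Type u} [Ring A] {P : Type u} [AddCommGroup P] [Module A P]
    [Module.Injective A P] (ι : P →ₗ[A] A) (hι : Function.Injective ι)
    (hr : ∀ y ∈ socle A P, ∀ a : A, ∃ z ∈ socle A P, ι z = ι y * a) (b : A) :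
    b ∈ socleIdeal A P ↔ ∃ y ∈ socle A P, ι y = b := by
  let I : TwoSidedIdeal A := TwoSidedIdeal.mk' (ι '' (socle A P : Set P))
    ⟨0, zero_mem _, map_zero ι⟩
    (by rintro _ _ ⟨y, hy, rfl⟩ ⟨z, hz, rfl⟩; exact ⟨y + z, add_mem hy hz, map_add ι y z⟩)
    (by rintro _ ⟨y, hy, rfl⟩; exact ⟨-y, neg_mem hy, map_neg ι y⟩)
    (by rintro a _ ⟨y, hy, rfl⟩; exact ⟨a • y, Submodule.smul_mem _ _ hy, by simp⟩)
    (by rintro _ a ⟨y, hy, rfl⟩; exact hr y hy a)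
  rw [socleIdeal_eq_span ι hι]
  constructor
  · intro hb
    have hle : TwoSidedIdeal.span (ι '' (socle A P : Set P)) ≤ I :=
      TwoSidedIdeal.span_le.2 fun c hc => (TwoSidedIdeal.mem_mk' _ _ _ _ _ _ c).2 hc
    exact (TwoSidedIdeal.mem_mk' _ _ _ _ _ _ b).1 (hle hb)
  · rintro ⟨y, hy, rfl⟩
    exact TwoSidedIdeal.subset_span ⟨y, hy, rfl⟩

/-! ### Representation dimension -/

/-- `X` belongs to `add Z`: it is isomorphic to a direct summand of a finite direct sum of copies
of `Z`. -/
def InAdd (A : Type u) [Ring A] (X : Type v) [AddCommGroup X] [Module A X]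
    (Z : Type w) [AddCommGroup Z] [Module A Z] : Prop :=
  ∃ (n : ℕ) (i : X →ₗ[A] (Fin n → Z)) (p : (Fin n → Z) →ₗ[A] X), p ∘ₗ i = LinearMap.id

/-- The dual `A^* = Hom_k(A, k)` of the right `A`-module `A`. -/
def DualModule (k : Type u) [Field k] (A : Type v) [Ring A] [Algebra k A] : Type (max u v) :=
  A →ₗ[k] k

namespace DualModule

variable (k : Type u) [Field k] (A : Type v) [Ring A] [Algebra k A]

instance : AddCommGroup (DualModule k A) := inferInstanceAs (AddCommGroup (A →ₗ[k] k))

variable {k A} in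
/-- An element of `A^*` as a linear form. -/
def toLinearMap (f : DualModule k A) : A →ₗ[k] k := f

/-- The left `A`-module structure on `A^*`, given by `(a f) x = f (x a)`. -/
instance : Module A (DualModule k A) where
  smul a f := f.toLinearMap ∘ₗ LinearMap.mulRight k a
  one_smul f := LinearMap.ext fun y => congrArg f.toLinearMap (mul_one y)
  mul_smul a b f := LinearMap.ext fun y =>
    congrArg f.toLinearMap (mul_assoc y a b).symm
  smul_zero _ := LinearMap.ext fun _ => rfl
  smul_add _ _ _ := LinearMap.ext fun _ => rfl
  add_smul a b f := LinearMap.ext fun y =>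
    (congrArg f.toLinearMap (mul_add y a b)).trans
      (map_add f.toLinearMap (y * a) (y * b))
  zero_smul f := LinearMap.ext fun y =>
    (congrArg f.toLinearMap (mul_zero y)).trans (map_zero f.toLinearMap)

end DualModule

/-- A generator-cogenerator of a finite-dimensional `k`-algebra `A`: a finite-dimensional
(equivalently, finitely generated) left `A`-module `Z` with `A ⊕ A^*` in `add Z`. -/
def IsGeneratorCogenerator (k : Type u) [Field k] (A : Type v) [Ring A] [Algebra k A]
    (Z : Type w) [AddCommGroup Z] [Module A Z] : Prop :=
  Module.Finite A Z ∧ InAdd A (A × DualModule k A) Z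

/-- The global dimension of a finite-dimensional algebra `E`: the supremum of the projective
dimensions of the finite-dimensional (equivalently, finitely generated) left `E`-modules. -/
def gldim (E : Type u) [Ring E] : WithBot ℕ∞ :=
  ⨆ T : {T : ModuleCat.{u} E // Module.Finite E T}, projectiveDimension T.1

/-- The representation dimension of a finite-dimensional `k`-algebra `A`: the minimum of the global
dimensions of the endomorphism algebras of the generator-cogenerators of `A`. -/
def repdim (k : Type u) [Field k] (A : Type v) [Ring A] [Algebra k A] : WithBot ℕ∞ :=
  sInf {d | ∃ (Z : Type v) (_ : AddCommGroup Z) (_ : Module A Z),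
    IsGeneratorCogenerator k A Z ∧ d = gldim (Module.End A Z)}

end RepDim

end

open CategoryTheory

namespace RepDim

/-! ### Projective dimension of modules and exact sequences of linear maps -/

/-! The bound is Auslander's criterion applied to `Z × P`, where `Z` is a generator-cogenerator of
`B` whose endomorphism algebra has global dimension at most 3. Write `E` for the endomorphism
algebra of `Z`. The contravariant functor `Hom(-, Z)` turns right exact sequences of modules into
left exact sequences of left `E`-modules, and sends `add Z` to projectives. Hence the modules
`Hom(X, Z)` occur as second syzygies of `E`-modules and supply second syzygies for all finitely
generated ones, so `gldim E ≤ 3` amounts to `Hom(X, Z)` having projective dimension at most 1 for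
all finitely generated `X` (`pdLT_hom_of_gldim_le`, `gldim_le_of_pdLT_hom`). For a cogenerator `Z`
this yields an exact sequence `0 → X → Z^n → W → 0` with `W` in `add Z` that stays exact under
`Hom(-, Z)` (`exists_coresolution`). The passage from `B` to `A` rests on
`IsIndecomposable.exists_decomposition`: every Artinian `A`-module is a summand of a power of `P`
plus a module killed by the socle ideal, that is, a `B`-module. Applied to `A` and `A^*`, this makes
`Z × P` a generator-cogenerator. Applied to a finitely generated `X`, it leaves a `B`-module, whose
coresolution over `B` also stays exact under `Hom(-, P)` because `P` is injective (`pdLT_hom_prod`).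
-/

/-- The module `M` has projective dimension less than `n`. -/
abbrev PdLT (E : Type v) [Ring E] (M : Type v) [AddCommGroup M] [Module E M] (n : ℕ) : Prop :=
  HasProjectiveDimensionLT (ModuleCat.of E M) n

section ProjectiveDimension

variable {E : Type v} [Ring E] {L M N : Type v} [AddCommGroup L] [AddCommGroup M] [AddCommGroup N]
  [Module E L] [Module E M] [Module E N]

theorem pdLT_one_iff : PdLT E M 1 ↔ Module.Projective E M := by
  rw [PdLT, ← projective_iff_hasProjectiveDimensionLT_one, ← IsProjective.iff_projective]

theorem PdLT.mono {m n : ℕ} (h : PdLT E M m) (hmn : m ≤ n) : PdLT E M n :=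
  hasProjectiveDimensionLT_of_ge _ m n hmn

theorem shortExact_of_exact (f : L →ₗ[E] M) (g : M →ₗ[E] N) (hf : Function.Injective f)
    (hg : Function.Surjective g) (h : Function.Exact f g) :
    (ModuleCat.shortComplexOfCompEqZero f g h.linearMap_comp_eq_zero).ShortExact :=
  ModuleCat.shortComplex_shortExact _ h hf hg

theorem PdLT.of_exact_left (f : L →ₗ[E] M) (g : M →ₗ[E] N) (hf : Function.Injective f)
    (hg : Function.Surjective g) (h : Function.Exact f g) {n : ℕ}
    (hM : PdLT E M n) (hN : PdLT E N (n + 1)) : PdLT E L n :=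
  (shortExact_of_exact f g hf hg h).hasProjectiveDimensionLT_X₁ n hM hN

theorem PdLT.of_exact_middle (f : L →ₗ[E] M) (g : M →ₗ[E] N) (hf : Function.Injective f)
    (hg : Function.Surjective g) (h : Function.Exact f g) {n : ℕ}
    (hL : PdLT E L n) (hN : PdLT E N n) : PdLT E M n :=
  (shortExact_of_exact f g hf hg h).hasProjectiveDimensionLT_X₂ n hL hN

theorem PdLT.of_exact_right (f : L →ₗ[E] M) (g : M →ₗ[E] N) (hf : Function.Injective f)
    (hg : Function.Surjective g) (h : Function.Exact f g) {n : ℕ}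
    (hL : PdLT E L n) (hM : PdLT E M (n + 1)) : PdLT E N (n + 1) :=
  (shortExact_of_exact f g hf hg h).hasProjectiveDimensionLT_X₃ n hL hM

theorem PdLT.prod {n : ℕ} (hL : PdLT E L n) (hN : PdLT E N n) : PdLT E (L × N) n :=
  .of_exact_middle (LinearMap.inl E L N) (LinearMap.snd E L N) LinearMap.inl_injective
    LinearMap.snd_surjective .inl_snd hL hN

theorem PdLT.of_retract {n : ℕ} (i : L →ₗ[E] M) (p : M →ₗ[E] L) (h : p ∘ₗ i = LinearMap.id)
    (hM : PdLT E M n) : PdLT E L n :=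
  Retract.hasProjectiveDimensionLT
    (h := ⟨ModuleCat.ofHom i, ModuleCat.ofHom p, by rw [← ModuleCat.ofHom_comp, h]; rfl⟩) n

theorem gldim_le_iff (n : ℕ) : gldim E ≤ n ↔
    ∀ (T : Type v) [AddCommGroup T] [Module E T], Module.Finite E T → PdLT E T (n + 1) := by
  rw [gldim, iSup_le_iff]
  constructor
  · intro h T _ _ hT
    exact (projectiveDimension_le_iff _ _).1 (h ⟨ModuleCat.of E T, hT⟩)
  · rintro h ⟨T, hT⟩
    exact (projectiveDimension_le_iff _ _).2 (h T hT)

end ProjectiveDimension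

/-! ### The class `add Z` -/

section Add

variable {A : Type u} [Ring A]

section

variable {X Y W : Type*} [AddCommGroup X] [Module A X] [AddCommGroup Y] [Module A Y]
  [AddCommGroup W] [Module A W] {Z : Type w} [AddCommGroup Z] [Module A Z]

theorem InAdd.of_retract (hY : InAdd A Y Z) (i : X →ₗ[A] Y) (p : Y →ₗ[A] X)
    (h : p ∘ₗ i = LinearMap.id) : InAdd A X Z := by
  obtain ⟨n, j, q, hq⟩ := hY
  refine ⟨n, j ∘ₗ i, p ∘ₗ q, ?_⟩
  ext x
  have h1 : q (j (i x)) = i x := LinearMap.congr_fun hq (i x)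
  have h2 : p (i x) = x := LinearMap.congr_fun h x
  simp [h1, h2]

theorem InAdd.of_pi_retract {ι : Type*} [Finite ι] (i : X →ₗ[A] (ι → Z)) (p : (ι → Z) →ₗ[A] X)
    (h : p ∘ₗ i = LinearMap.id) : InAdd A X Z := by
  obtain ⟨n, ⟨e⟩⟩ := Finite.exists_equiv_fin ι
  let f : (ι → Z) ≃ₗ[A] (Fin n → Z) := LinearEquiv.funCongrLeft A Z e.symm
  refine ⟨n, f.toLinearMap ∘ₗ i, p ∘ₗ f.symm.toLinearMap, ?_⟩
  ext x
  simpa using LinearMap.congr_fun h x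

theorem InAdd.pi_self (ι : Type*) [Finite ι] : InAdd A (ι → Z) Z :=
  .of_pi_retract LinearMap.id LinearMap.id rfl

theorem InAdd.self : InAdd A Z Z :=
  .of_retract (InAdd.pi_self (Fin 1)) (LinearMap.pi fun _ => LinearMap.id) (LinearMap.proj 0) rfl

theorem InAdd.pi {ι : Type*} [Finite ι] (hX : InAdd A X Z) : InAdd A (ι → X) Z := by
  obtain ⟨n, j, q, hq⟩ := hX
  refine .of_pi_retract (ι := ι × Fin n)
    (LinearMap.pi fun s => LinearMap.proj s.2 ∘ₗ j ∘ₗ LinearMap.proj s.1)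
    (LinearMap.pi fun a => q ∘ₗ LinearMap.pi fun b => LinearMap.proj (a, b)) ?_
  exact LinearMap.ext fun x => funext fun a => LinearMap.congr_fun hq (x a)

theorem InAdd.prod (hX : InAdd A X Z) (hY : InAdd A Y Z) : InAdd A (X × Y) Z := by
  obtain ⟨m, i, p, h⟩ := hX
  obtain ⟨n, j, q, h'⟩ := hY
  refine .of_pi_retract (ι := Fin m ⊕ Fin n)
    (LinearMap.pi fun s => s.elim (fun a => LinearMap.proj a ∘ₗ i ∘ₗ LinearMap.fst A X Y)
      fun b => LinearMap.proj b ∘ₗ j ∘ₗ LinearMap.snd A X Y)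
    (LinearMap.prod (p ∘ₗ LinearMap.pi fun a => LinearMap.proj (Sum.inl a))
      (q ∘ₗ LinearMap.pi fun b => LinearMap.proj (Sum.inr b))) ?_
  refine LinearMap.ext fun x => Prod.ext ?_ ?_
  · exact LinearMap.congr_fun h x.1
  · exact LinearMap.congr_fun h' x.2

theorem InAdd.trans (hX : InAdd A X W) (hW : InAdd A W Z) : InAdd A X Z := by
  obtain ⟨n, j, q, hq⟩ := hX
  exact .of_retract (hW.pi (ι := Fin n)) j q hq

end

end Add

/-! ### Modules of homomorphisms into `Z` over the endomorphism algebra of `Z` -/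

section HomIntoZ

variable {A : Type u} [Ring A] {X Y W : Type*} [AddCommGroup X] [Module A X] [AddCommGroup Y]
  [Module A Y] [AddCommGroup W] [Module A W] (Z : Type v) [AddCommGroup Z] [Module A Z]

/-- Precomposition with `f`, as a map of modules over the endomorphism algebra of `Z`. -/
def precomp (f : X →ₗ[A] Y) : (Y →ₗ[A] Z) →ₗ[Module.End A Z] (X →ₗ[A] Z) where
  toFun h := h ∘ₗ f
  map_add' _ _ := rfl
  map_smul' _ _ := rfl

variable {Z}

theorem exists_comp_eq_of_ker_le {g : X →ₗ[A] Y} (hg : Function.Surjective g) {l : X →ₗ[A] W}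
    (h : LinearMap.ker g ≤ LinearMap.ker l) : ∃ m : Y →ₗ[A] W, m ∘ₗ g = l := by
  refine ⟨(LinearMap.ker g).liftQ l h ∘ₗ (g.quotKerEquivOfSurjective hg).symm.toLinearMap, ?_⟩
  ext y
  have : (g.quotKerEquivOfSurjective hg).symm (g y) = (LinearMap.ker g).mkQ y := by
    rw [LinearEquiv.symm_apply_eq]; rfl
  simp [this]

@[simp] theorem precomp_apply (f : X →ₗ[A] Y) (h : Y →ₗ[A] Z) : precomp Z f h = h ∘ₗ f := rfl

theorem precomp_injective {f : X →ₗ[A] Y} (hf : Function.Surjective f) :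
    Function.Injective (precomp Z f) := fun _ _ h =>
  LinearMap.cancel_right hf |>.1 h

theorem precomp_exact {f : X →ₗ[A] Y} {g : Y →ₗ[A] W} (hg : Function.Surjective g)
    (h : Function.Exact f g) : Function.Exact (precomp Z g) (precomp Z f) := by
  intro l
  constructor
  · intro hl
    refine exists_comp_eq_of_ker_le hg fun y hy => ?_
    obtain ⟨x, rfl⟩ := (h y).1 hy
    exact LinearMap.congr_fun hl x
  · rintro ⟨m, rfl⟩
    ext x
    simp [h.apply_apply_eq_zero]

theorem projective_hom_of_inAdd (h : InAdd A X Z) :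
    Module.Projective (Module.End A Z) (X →ₗ[A] Z) := by
  obtain ⟨n, i, p, hp⟩ := h
  have : Module.Projective (Module.End A Z) ((Fin n → Z) →ₗ[A] Z) :=
    Module.Projective.of_equiv' (LinearMap.lsum A (fun _ : Fin n => Z) (Module.End A Z))
  refine Module.Projective.of_split (precomp Z p) (precomp Z i) ?_
  ext f x
  have h1 : p (i x) = x := LinearMap.congr_fun hp x
  simp [h1]

/-- A left approximation of `X` by a finite power of `Z`. -/
theorem exists_approximation [Module.Finite (Module.End A Z) (X →ₗ[A] Z)] :
    ∃ (n : ℕ) (f : X →ₗ[A] (Fin n → Z)), Function.Surjective (precomp Z f) := by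
  obtain ⟨n, s, hs⟩ := Module.Finite.exists_fin (R := Module.End A Z) (M := X →ₗ[A] Z)
  -- The coordinates of the approximation generate `Hom(X, Z)` over the endomorphism algebra.
  refine ⟨n, LinearMap.pi s, fun h => ?_⟩
  obtain ⟨c, rfl⟩ := (Submodule.mem_span_range_iff_exists_fun _).1
    (hs ▸ Submodule.mem_top : h ∈ Submodule.span (Module.End A Z) (Set.range s))
  refine ⟨∑ i, c i ∘ₗ LinearMap.proj i, ?_⟩
  ext x
  simp

/-- Linear maps out of `Hom(Z^n, Z)` over the endomorphism algebra of `Z` are precompositions. -/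
theorem exists_eq_precomp {n : ℕ}
    (s : ((Fin n → Z) →ₗ[A] Z) →ₗ[Module.End A Z] (X →ₗ[A] Z)) :
    ∃ r : X →ₗ[A] (Fin n → Z), s = precomp Z r := by
  refine ⟨LinearMap.pi fun i => s (LinearMap.proj i), LinearMap.ext fun h => ?_⟩
  -- The projections generate `Hom(Z^n, Z)`, so `s` is determined by their images, which are the
  -- coordinates of `r`.
  have key : h = ∑ i, (h ∘ₗ LinearMap.single A (fun _ => Z) i : Module.End A Z) •
      (LinearMap.proj i : (Fin n → Z) →ₗ[A] Z) := by
    ext i z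
    simp [Pi.single_apply, apply_ite]
  rw [key, map_sum]
  ext x
  simp

/-- The module `Z` cogenerates the finitely generated modules of a given universe. -/
def Cogenerates (A : Type u) [Ring A] (Z : Type v) [AddCommGroup Z] [Module A Z] : Prop :=
  ∀ (X : Type v) [AddCommGroup X] [Module A X], Module.Finite A X →
    ∃ (ι : Type) (f : X →ₗ[A] (ι → Z)), Function.Injective f

/-- Every map `X → Z` factors through `f`, so the kernel of `f` is killed by a family of maps that
separates points. -/
theorem injective_of_precomp_surjective {n : ℕ} {f : X →ₗ[A] (Fin n → Z)} {ι : Type*}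
    {j : X →ₗ[A] (ι → Z)} (hj : Function.Injective j) (hf : Function.Surjective (precomp Z f)) :
    Function.Injective f := by
  rw [← LinearMap.ker_eq_bot, LinearMap.ker_eq_bot']
  intro x hx
  apply hj
  ext i
  obtain ⟨h, hh⟩ := hf (LinearMap.proj i ∘ₗ j)
  have h1 : h (f x) = j x i := LinearMap.congr_fun hh x
  simp [← h1, hx]

/-- Projectivity splits the surjection induced by an approximation `f : X → Z^n`. The resulting
endomorphism of `Hom(Z^n, Z)` is precomposition with some `r : Z^n → Z^n`, and `r` is a retraction
onto the image of `f`: it fixes that image by the splitting, and maps into it because `Z`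
cogenerates the cokernel of `f`. -/
theorem inAdd_of_projective_hom {X : Type v} [AddCommGroup X] [Module A X] [Module.Finite A X]
    [Module.Finite A Z]
    [Module.Finite (Module.End A Z) (X →ₗ[A] Z)] (hZ : Cogenerates A Z)
    [Module.Projective (Module.End A Z) (X →ₗ[A] Z)] : InAdd A X Z := by
  obtain ⟨n, f, hf⟩ := exists_approximation (A := A) (X := X) (Z := Z)
  obtain ⟨_, j, hj⟩ := hZ X inferInstance
  have hfi := injective_of_precomp_surjective hj hf
  obtain ⟨s, hs⟩ := Module.projective_lifting_property (precomp Z f) LinearMap.id hf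
  obtain ⟨_, θ, hθ⟩ := hZ ((Fin n → Z) ⧸ LinearMap.range f) inferInstance
  obtain ⟨r, hr⟩ := exists_eq_precomp (s ∘ₗ precomp Z f)
  have hrange (z : Fin n → Z) : r z ∈ LinearMap.range f := by
    rw [← Submodule.Quotient.mk_eq_zero]
    apply hθ
    ext i
    have h1 := LinearMap.congr_fun hr (LinearMap.proj i ∘ₗ θ ∘ₗ (LinearMap.range f).mkQ)
    have h2 : (LinearMap.proj i ∘ₗ θ ∘ₗ (LinearMap.range f).mkQ) ∘ₗ f = 0 := by
      ext x
      have : (Submodule.Quotient.mk (f x) : (Fin n → Z) ⧸ LinearMap.range f) = 0 :=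
        (Submodule.Quotient.mk_eq_zero _).2 ⟨x, rfl⟩
      simp [this]
    rw [LinearMap.comp_apply, precomp_apply, h2, map_zero] at h1
    simpa using (LinearMap.congr_fun h1 z).symm
  have hrf : r ∘ₗ f = f := by
    ext x i
    have h1 := LinearMap.congr_fun hs (LinearMap.proj i ∘ₗ f)
    have h2 := LinearMap.congr_fun hr (LinearMap.proj i)
    simp only [LinearMap.comp_apply, precomp_apply] at h1 h2
    rw [h2] at h1
    exact LinearMap.congr_fun h1 x
  refine ⟨n, f, (LinearEquiv.ofInjective f hfi).symm.toLinearMap ∘ₗ r.codRestrict _ hrange, ?_⟩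
  ext x
  simp only [LinearMap.comp_apply, LinearEquiv.coe_coe, LinearMap.id_apply,
    LinearEquiv.symm_apply_eq]
  exact Subtype.ext (LinearMap.congr_fun hrf x)

end HomIntoZ

/-! ### Second syzygies and projective dimension -/

section ProjectiveDimension

variable {E : Type v} [Ring E] {L M₁ M₀ N : Type v} [AddCommGroup L] [AddCommGroup M₁]
  [AddCommGroup M₀] [AddCommGroup N] [Module E L] [Module E M₁] [Module E M₀] [Module E N]

theorem exact_rangeRestrict {i : L →ₗ[E] M₁} {d : M₁ →ₗ[E] M₀} (h : Function.Exact i d) :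
    Function.Exact i d.rangeRestrict := fun x => by
  rw [← h x, ← Subtype.coe_inj]; rfl

theorem exact_range_subtype {d : M₁ →ₗ[E] M₀} {p : M₀ →ₗ[E] N} (h : Function.Exact d p) :
    Function.Exact (LinearMap.range d).subtype p := fun x => by
  rw [h x]; simp

/-- `L` is a second syzygy of `N`. The sequence is cut at the range of `d`, and each half lowers the
bound by one; the bound `n + 1` leaves room for the projective middle terms. -/
theorem PdLT.of_exact₄_left (i : L →ₗ[E] M₁) (d : M₁ →ₗ[E] M₀) (p : M₀ →ₗ[E] N)
    (hi : Function.Injective i) (hp : Function.Surjective p) (h₁ : Function.Exact i d)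
    (h₀ : Function.Exact d p) (hM₁ : Module.Projective E M₁) (hM₀ : Module.Projective E M₀)
    {n : ℕ} (hN : PdLT E N (n + 1 + 2)) : PdLT E L (n + 1) := by
  rw [← pdLT_one_iff] at hM₁ hM₀
  have hK : PdLT E (LinearMap.range d) (n + 1 + 1) :=
    .of_exact_left _ p (Submodule.injective_subtype _) hp (exact_range_subtype h₀)
      (hM₀.mono (by omega)) hN
  exact .of_exact_left i _ hi d.surjective_rangeRestrict (exact_rangeRestrict h₁)
      (hM₁.mono (by omega)) hK

theorem PdLT.of_exact₄_right (i : L →ₗ[E] M₁) (d : M₁ →ₗ[E] M₀) (p : M₀ →ₗ[E] N)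
    (hi : Function.Injective i) (hp : Function.Surjective p) (h₁ : Function.Exact i d)
    (h₀ : Function.Exact d p) (hM₁ : Module.Projective E M₁) (hM₀ : Module.Projective E M₀)
    {n : ℕ} (hL : PdLT E L n) : PdLT E N (n + 2) := by
  rw [← pdLT_one_iff] at hM₁ hM₀
  have hK : PdLT E (LinearMap.range d) (n + 1) :=
    .of_exact_right i _ hi d.surjective_rangeRestrict (exact_rangeRestrict h₁) hL
      (hM₁.mono (by omega))
  exact .of_exact_right _ p (Submodule.injective_subtype _) hp (exact_range_subtype h₀) hK
      (hM₀.mono (by omega))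

end ProjectiveDimension

theorem exists_presentation (A : Type u) [Ring A] [IsNoetherianRing A] (X : Type w)
    [AddCommGroup X] [Module A X] [Module.Finite A X] :
    ∃ (m n : ℕ) (d : (Fin m → A) →ₗ[A] (Fin n → A)) (p : (Fin n → A) →ₗ[A] X),
      Function.Surjective p ∧ Function.Exact d p := by
  obtain ⟨n, p, hp⟩ := Module.Finite.exists_fin' A X
  obtain ⟨m, q, hq⟩ := Module.Finite.exists_fin' A (LinearMap.ker p)
  refine ⟨m, n, (LinearMap.ker p).subtype ∘ₗ q, p, hp, fun x => ⟨fun hx => ?_, ?_⟩⟩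
  · obtain ⟨y, hy⟩ := hq ⟨x, hx⟩
    exact ⟨y, by simp [hy]⟩
  · rintro ⟨y, rfl⟩
    exact (q y).2

/-! ### Auslander's criterion: the global dimension of `End(Z)` through the modules `Hom(X, Z)` -/

section HomIntoZ

variable {A : Type v} [Ring A] {Z : Type v} [AddCommGroup Z] [Module A Z]

theorem finite_hom_of_inAdd {X : Type v} [AddCommGroup X] [Module A X] (h : InAdd A X Z) :
    Module.Finite (Module.End A Z) (X →ₗ[A] Z) := by
  obtain ⟨n, i, p, hp⟩ := h
  have : Module.Finite (Module.End A Z) ((Fin n → Z) →ₗ[A] Z) :=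
    Module.Finite.equiv (LinearMap.lsum A (fun _ : Fin n => Z) (Module.End A Z))
  refine Module.Finite.of_surjective (precomp Z i) fun f => ⟨f ∘ₗ p, ?_⟩
  ext x
  have h1 : p (i x) = x := LinearMap.congr_fun hp x
  simp [h1]

theorem finite_hom {X : Type v} [AddCommGroup X] [Module A X] [Module.Finite A X]
    [IsNoetherianRing (Module.End A Z)] (hA : InAdd A A Z) :
    Module.Finite (Module.End A Z) (X →ₗ[A] Z) := by
  obtain ⟨n, p, hp⟩ := Module.Finite.exists_fin' A X
  have := finite_hom_of_inAdd (hA.pi (ι := Fin n))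
  exact Module.Finite.of_injective (precomp Z p) (precomp_injective hp)

/-- A free presentation of `X` exhibits `Hom(X, Z)` as a second syzygy of a cokernel; the middle
terms `Hom(A^m, Z)` are projective because `A` lies in `add Z`. -/
theorem pdLT_hom_of_gldim_le [IsNoetherianRing A] {n : ℕ}
    (hZ : gldim (Module.End A Z) ≤ (n + 2 : ℕ)) (hA : InAdd A A Z) {X : Type v} [AddCommGroup X]
    [Module A X] [Module.Finite A X] : PdLT (Module.End A Z) (X →ₗ[A] Z) (n + 1) := by
  obtain ⟨a, b, d, p, hp, hdp⟩ := exists_presentation A X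
  have := finite_hom_of_inAdd (hA.pi (ι := Fin a))
  refine .of_exact₄_left (precomp Z p) (precomp Z d) (LinearMap.range (precomp Z d)).mkQ
    (precomp_injective hp) (Submodule.mkQ_surjective _) (precomp_exact hp hdp)
    (LinearMap.exact_map_mkQ_range _) (projective_hom_of_inAdd hA.pi)
    (projective_hom_of_inAdd hA.pi) ?_
  exact (gldim_le_iff _).1 hZ _ inferInstance

/-- A free presentation of an `End(Z)`-module `T` is, up to isomorphism, precomposition with a map
`f` between powers of `Z`. Its kernel is `Hom(coker f, Z)`, which is therefore a second syzygy of
`T`. -/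
theorem gldim_le_of_pdLT_hom [Module.Finite A Z] [IsNoetherianRing (Module.End A Z)] {n : ℕ}
    (h : ∀ (X : Type v) [AddCommGroup X] [Module A X], Module.Finite A X →
      PdLT (Module.End A Z) (X →ₗ[A] Z) (n + 1)) :
    gldim (Module.End A Z) ≤ (n + 2 : ℕ) := by
  refine (gldim_le_iff _).2 fun T _ _ hT => ?_
  obtain ⟨a, b, d, p, hp, hdp⟩ := exists_presentation (Module.End A Z) T
  let e (m : ℕ) : (Fin m → Module.End A Z) ≃ₗ[Module.End A Z] ((Fin m → Z) →ₗ[A] Z) :=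
    LinearMap.lsum A (fun _ => Z) (Module.End A Z)
  obtain ⟨f, hf⟩ := exists_eq_precomp
    ((e b).toLinearMap ∘ₗ d ∘ₗ (e a).symm.toLinearMap)
  refine .of_exact₄_right (precomp Z (LinearMap.range f).mkQ) (precomp Z f)
    (p ∘ₗ (e b).symm.toLinearMap) (precomp_injective (Submodule.mkQ_surjective _))
    (hp.comp (e b).symm.surjective)
    (precomp_exact (Submodule.mkQ_surjective _) (LinearMap.exact_map_mkQ_range _)) ?_
    (projective_hom_of_inAdd (InAdd.pi_self _)) (projective_hom_of_inAdd (InAdd.pi_self _))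
    (h _ inferInstance)
  rw [← hf]
  intro x
  obtain ⟨x, rfl⟩ := (e b).surjective x
  simp only [LinearMap.comp_apply, LinearEquiv.coe_coe, LinearEquiv.symm_apply_apply, hdp x,
    Set.mem_range, EmbeddingLike.apply_eq_iff_eq]
  exact ⟨fun ⟨y, hy⟩ => ⟨e a y, by simp [hy]⟩, fun ⟨y, hy⟩ => ⟨_, hy⟩⟩

theorem pdLT_two_of_coresolution {X Y W : Type v} [AddCommGroup X] [Module A X] [AddCommGroup Y]
    [Module A Y] [AddCommGroup W] [Module A W] {f : X →ₗ[A] Y} {g : Y →ₗ[A] W}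
    (hf : Function.Surjective (precomp Z f)) (hg : Function.Surjective g)
    (hfg : Function.Exact f g) (hY : InAdd A Y Z) (hW : InAdd A W Z) :
    PdLT (Module.End A Z) (X →ₗ[A] Z) 2 :=
  .of_exact_right _ _ (precomp_injective hg) hf (precomp_exact hg hfg)
    (pdLT_one_iff.2 (projective_hom_of_inAdd hW))
    ((pdLT_one_iff.2 (projective_hom_of_inAdd hY)).mono one_le_two)

/-- For `W` the cokernel of an approximation, `Hom(W, Z)` is a first syzygy of `Hom(X, Z)`, hence
projective, and so `W` lies in `add Z`. -/
theorem exists_coresolution [IsNoetherianRing (Module.End A Z)] [Module.Finite A Z]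
    (hA : InAdd A A Z) (hZ : Cogenerates A Z) {X : Type v} [AddCommGroup X] [Module A X]
    [Module.Finite A X] (hX : PdLT (Module.End A Z) (X →ₗ[A] Z) 2) :
    ∃ (n : ℕ) (W : Type v) (_ : AddCommGroup W) (_ : Module A W) (f : X →ₗ[A] (Fin n → Z))
      (g : (Fin n → Z) →ₗ[A] W), Function.Surjective (precomp Z f) ∧ Function.Injective f ∧
        Function.Surjective g ∧ Function.Exact f g ∧ InAdd A W Z := by
  have := finite_hom (X := X) hA
  obtain ⟨n, f, hf⟩ := exists_approximation (A := A) (X := X) (Z := Z)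
  obtain ⟨_, j, hj⟩ := hZ X inferInstance
  have hg : Function.Surjective (LinearMap.range f).mkQ := Submodule.mkQ_surjective _
  have hfg := LinearMap.exact_map_mkQ_range f
  refine ⟨n, (Fin n → Z) ⧸ LinearMap.range f, inferInstance, inferInstance, f, _, hf,
    injective_of_precomp_surjective hj hf, hg, hfg, ?_⟩
  have := finite_hom (X := (Fin n → Z) ⧸ LinearMap.range f) hA
  have hp : Module.Projective (Module.End A Z) (((Fin n → Z) ⧸ LinearMap.range f) →ₗ[A] Z) := by
    refine pdLT_one_iff.1 (.of_exact_left _ _ (precomp_injective hg) hf (precomp_exact hg hfg)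
      (pdLT_one_iff.2 (projective_hom_of_inAdd (InAdd.pi_self _))) hX)
  exact inAdd_of_projective_hom hZ

end HomIntoZ

/-! ### Fitting's lemma and splitting off copies of `P` -/

section Decomposition

variable {A : Type v} [Ring A] {P : Type v} [AddCommGroup P] [Module A P]

/-- An endomorphism of an indecomposable module of finite length is injective as soon as it fixes
a nonzero vector. -/
theorem IsIndecomposable.injective_of_fixed [IsNoetherian A P] [IsArtinian A P]
    (hP : IsIndecomposable A P) (h : Module.End A P) {y : P} (hy : y ≠ 0) (hy' : h y = y) :
    Function.Injective h := by
  -- Fitting decomposition for a power `h ^ n`; `n ≥ 1` is needed so that injectivity of `h ^ n`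
  -- passes to `h`.
  obtain ⟨n, hn, hc⟩ :=
    ((Filter.eventually_ge_atTop 1).and h.eventually_isCompl_ker_pow_range_pow).exists
  have hyn (m : ℕ) : (h ^ m) y = y := by
    induction m with
    | zero => rfl
    | succ m ih => rw [pow_succ, Module.End.mul_apply, hy', ih]
  rcases hP.2 _ _ hc with h0 | h0
  · have h1 : Function.Injective (h ^ n) := LinearMap.ker_eq_bot.1 h0
    obtain ⟨m, rfl⟩ : ∃ m, n = m + 1 := ⟨n - 1, by omega⟩
    rw [pow_succ, Module.End.mul_eq_comp, LinearMap.coe_comp] at h1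
    exact h1.of_comp
  · have : (h ^ n) y ∈ LinearMap.range (h ^ n) := ⟨y, rfl⟩
    rw [h0, hyn] at this
    exact absurd this hy

/-- A homomorphism from an indecomposable injective module of finite length is injective if it does
not vanish on the socle. -/
theorem IsIndecomposable.injective_of_apply_socle_ne_zero [IsNoetherian A P] [IsArtinian A P]
    [Module.Injective A P] (hP : IsIndecomposable A P) {X : Type w} [AddCommGroup X] [Module A X]
    (g : P →ₗ[A] X) {y : P} (hy : y ∈ socle A P) (hg : g y ≠ 0) : Function.Injective g := by
  obtain ⟨S, hS, hSg⟩ : ∃ S : Submodule A P, IsSimpleModule A S ∧ ¬ S ≤ LinearMap.ker g := by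
    by_contra! hc
    have : socle A P ≤ LinearMap.ker g := sSup_le hc
    exact hg (this hy)
  have hdisj : Disjoint (LinearMap.ker g) S := by
    have hatom := isSimpleModule_iff_isAtom.1 hS
    exact (hatom.not_le_iff_disjoint.1 hSg).symm
  let j : (LinearMap.ker g) × S →ₗ[A] P := (LinearMap.ker g).subtype.coprod S.subtype
  have hj : Function.Injective j := by
    rw [← LinearMap.ker_eq_bot]
    refine LinearMap.ker_coprod_of_disjoint_range _ _ (by simpa using hdisj) |>.trans ?_
    simp
  -- The projection of `ker g ⊕ S` onto `S` extends to an endomorphism `h` of `P`. It fixes `S`, so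
  -- it is injective, yet it kills `ker g`; hence `ker g = 0`.
  obtain ⟨h, hh⟩ := Module.Injective.extension_property A P _ _ j hj
    (S.subtype ∘ₗ LinearMap.snd A (LinearMap.ker g) S)
  have hk (x : LinearMap.ker g) : h x = 0 := by
    simpa [j] using LinearMap.congr_fun hh (x, 0)
  have hs (x : S) : h x = x := by
    simpa [j] using LinearMap.congr_fun hh (0, x)
  obtain ⟨s, hs0⟩ := @exists_ne S (IsSimpleModule.nontrivial A S) 0
  have hinj := hP.injective_of_fixed h (y := s) (by simpa using hs0) (hs s)
  rw [← LinearMap.ker_eq_bot, LinearMap.ker_eq_bot']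
  intro x hx
  exact hinj ((hk ⟨x, hx⟩).trans (map_zero h).symm)

/-- A two-sided ideal annihilates a module if a generating set does. -/
theorem smul_eq_zero_of_mem_span {X : Type w} [AddCommGroup X] [Module A X] {s : Set A}
    (hs : ∀ a ∈ s, ∀ x : X, a • x = 0) {c : A} (hc : c ∈ TwoSidedIdeal.span s) (x : X) :
    c • x = 0 := by
  have h : TwoSidedIdeal.span s ≤ TwoSidedIdeal.ker (Module.toAddMonoidEnd A X) := by
    refine TwoSidedIdeal.span_le.2 fun a ha => ?_
    exact (TwoSidedIdeal.mem_ker _).2 (AddMonoidHom.ext (hs a ha))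
  exact DFunLike.congr_fun ((TwoSidedIdeal.mem_ker _).1 (h hc)) x

/-- Splitting off copies of an indecomposable injective module `P`: the identity of `X` is the sum
of a map factoring through a power of `P` and of an idempotent endomorphism whose image is
annihilated by the ideal given by the socle of `P`. -/
theorem IsIndecomposable.exists_decomposition [IsNoetherian A P] [IsArtinian A P]
    [Module.Injective A P] (hP : IsIndecomposable A P) (X : Type w) [AddCommGroup X] [Module A X]
    [IsArtinian A X] :
    ∃ (e : X →ₗ[A] X) (n : ℕ) (a : X →ₗ[A] (Fin n → P)) (b : (Fin n → P) →ₗ[A] X),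
      b ∘ₗ a + e = LinearMap.id ∧ ∀ c ∈ socleIdeal A P, ∀ x : X, c • e x = 0 := by
  let good : Set (Submodule A X) := {U | ∃ (e : X →ₗ[A] X) (n : ℕ) (a : X →ₗ[A] (Fin n → P))
    (b : (Fin n → P) →ₗ[A] X), b ∘ₗ a + e = LinearMap.id ∧ e ∘ₗ e = e ∧ LinearMap.range e = U}
  have hgood : good.Nonempty := ⟨⊤, LinearMap.id, 0, 0, 0, by simp, rfl, LinearMap.range_id⟩
  -- `X` is Artinian, so an idempotent of minimal range exists. If the ideal did not annihilate this
  -- range, one more copy of `P` could be split off.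
  obtain ⟨_, ⟨e, n, a, b, hab, hee, rfl⟩, hmin⟩ := WellFounded.has_min wellFounded_lt good hgood
  refine ⟨e, n, a, b, hab, fun c hc x => ?_⟩
  suffices h : c • (⟨e x, x, rfl⟩ : LinearMap.range e) = 0 from congrArg Subtype.val h
  refine smul_eq_zero_of_mem_span ?_ hc _
  rintro _ ⟨ι, -, y, hy, rfl⟩ ⟨_, z, rfl⟩
  by_contra hne
  -- `j p = ι p • e z` is nonzero at the socle element `y`, hence injective, and it lands in the
  -- range of `e`; injectivity of `P` gives a retraction `q`.
  let j : P →ₗ[A] X := LinearMap.toSpanSingleton A X (e z) ∘ₗ ι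
  have hj : Function.Injective j := by
    refine hP.injective_of_apply_socle_ne_zero j hy fun h => hne ?_
    exact Subtype.ext h
  obtain ⟨q, hq⟩ := Module.Injective.extension_property A P _ _ j hj LinearMap.id
  have hee' (x : X) : e (e x) = e x := LinearMap.congr_fun hee x
  have hej (p : P) : e (j p) = j p := by simp [j, hee']
  have hqj (p : P) : q (j p) = p := LinearMap.congr_fun hq p
  -- Removing the summand `j(P)` from the range of `e`: since `q` vanishes on the range of `e'`, the
  -- map `e'` is idempotent and its range meets `j(P)` only in zero.
  let e' : X →ₗ[A] X := e - j ∘ₗ q ∘ₗ e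
  have hqe' (x : X) : q (e' x) = 0 := by simp [e', hqj]
  refine hmin (LinearMap.range e') ⟨e', n + 1,
    LinearMap.pi (Fin.cons (q ∘ₗ e) fun i => LinearMap.proj i ∘ₗ a),
    j ∘ₗ LinearMap.proj 0 + b ∘ₗ LinearMap.pi fun i => LinearMap.proj i.succ, ?_, ?_, rfl⟩ ?_
  · ext x
    have h1 : b (a x) + e x = x := LinearMap.congr_fun hab x
    have h2 : b (a x) + (j (q (e x)) + (e x - j (q (e x)))) = x := by
      rw [add_sub_cancel, h1]
    have h3 : (LinearMap.pi fun i => LinearMap.proj i.succ : (Fin (n + 1) → P) →ₗ[A] (Fin n → P))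
        (LinearMap.pi (φ := fun _ => P) (Fin.cons (q ∘ₗ e) fun i => LinearMap.proj i ∘ₗ a) x) =
          a x := by
      ext i
      simp
    simp only [LinearMap.add_apply, LinearMap.comp_apply, h3]
    simp only [e', LinearMap.pi_apply, LinearMap.proj_apply, Fin.cons_zero, LinearMap.comp_apply,
      LinearMap.sub_apply, LinearMap.id_apply]
    refine Eq.trans ?_ h2
    abel
  · ext x
    have : e (e' x) = e' x := by simp [e', hee', hej]
    change e (e' x) - j (q (e (e' x))) = e' x
    rw [this, hqe', map_zero, sub_zero]
  · refine lt_of_le_of_ne ?_ fun h => ?_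
    · rintro _ ⟨x, rfl⟩
      exact ⟨e' x, by simp [e', hee', hej]⟩
    · obtain ⟨p, hp⟩ := @exists_ne P hP.1 0
      have : j p ∈ LinearMap.range e' := h ▸ ⟨j p, hej p⟩
      obtain ⟨x, hx⟩ := this
      apply hp
      rw [← hqj p, ← hx, hqe']

end Decomposition

/-! ### Finite-dimensional algebras and duality -/

section FiniteDimensional

variable (k : Type u) [Field k] {A : Type v} [Ring A] [Algebra k A]

theorem DualModule.smul_apply (a : A) (f : DualModule k A) (x : A) :
    (a • f).toLinearMap x = f.toLinearMap (x * a) := rfl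

/-- The vector space structure on a module over a `k`-algebra. -/
abbrev vectorSpace (A : Type v) [Ring A] [Algebra k A] (X : Type w) [AddCommGroup X]
    [Module A X] : Module k X :=
  Module.compHom X (algebraMap k A)

theorem isScalarTower_vectorSpace (X : Type w) [AddCommGroup X] [Module A X] :
    letI := vectorSpace k A X
    IsScalarTower k A X := by
  let := vectorSpace k A X
  refine ⟨fun c a x => ?_⟩
  rw [Algebra.smul_def, mul_smul]
  rfl

theorem isNoetherianRing_end [FiniteDimensional k A] (Z : Type w) [AddCommGroup Z] [Module A Z]
    [Module.Finite A Z] : IsNoetherianRing (Module.End A Z) := by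
  let := vectorSpace k A Z
  have := isScalarTower_vectorSpace k (A := A) Z
  have := Module.Finite.trans (R := k) A Z
  have : SMulCommClass A k Z := IsScalarTower.to_smulCommClass'
  let r : Module.End A Z →ₗ[k] Module.End k Z :=
    { toFun := fun f => f.restrictScalars k
      map_add' := fun _ _ => rfl
      map_smul' := fun _ _ => rfl }
  have hr : Function.Injective r := fun f g h =>
    LinearMap.ext fun x => LinearMap.congr_fun h x
  have : Module.Finite k (Module.End A Z) := Module.Finite.of_injective r hr
  exact isNoetherian_of_tower k inferInstance

theorem isNoetherianRing_of_finiteDimensional [FiniteDimensional k A] : IsNoetherianRing A :=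
  isNoetherian_of_tower k inferInstance

theorem isArtinianRing_of_finiteDimensional [FiniteDimensional k A] : IsArtinianRing A :=
  isArtinian_of_tower k inferInstance

theorem isArtinian_dualModule [FiniteDimensional k A] : IsArtinian A (DualModule k A) := by
  let : Module k (DualModule k A) := inferInstanceAs (Module k (A →ₗ[k] k))
  have : Module.Finite k (DualModule k A) := inferInstanceAs (Module.Finite k (A →ₗ[k] k))
  have : IsScalarTower k A (DualModule k A) := by
    refine ⟨fun c a f => LinearMap.ext fun x => ?_⟩
    exact (congrArg f.toLinearMap (mul_smul_comm c x a)).trans (map_smul f.toLinearMap c (x * a))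
  exact isArtinian_of_tower k inferInstance

/-- The homomorphism into the dual of the algebra given by a linear form. -/
def toDualModule {X : Type w} [AddCommGroup X] [Module A X] [Module k X] [IsScalarTower k A X]
    (f : X →ₗ[k] k) : X →ₗ[A] DualModule k A where
  toFun x := f ∘ₗ (LinearMap.toSpanSingleton A X x).restrictScalars k
  map_add' x y := LinearMap.ext fun a => by simp; rfl
  map_smul' a x := LinearMap.ext fun b =>
    congrArg f ((smul_smul b a x).trans rfl)

/-- Linear forms on `X` give `A`-maps `X → A^*`, and evaluation at 1 recovers the form. The
coordinate forms of a basis therefore embed `X` into a power of `A^*`, and `A^*` embeds into a power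
of `Z`. -/
theorem cogenerates_of_inAdd_dualModule [FiniteDimensional k A] {Z : Type v} [AddCommGroup Z]
    [Module A Z] (h : InAdd A (DualModule k A) Z) : Cogenerates A Z := by
  intro X _ _ _
  let := vectorSpace k A X
  have := isScalarTower_vectorSpace k (A := A) X
  have := Module.Finite.trans (R := k) A X
  obtain ⟨n, i, p, hp⟩ := h
  have hi : Function.Injective i := Function.LeftInverse.injective (g := p) (LinearMap.congr_fun hp)
  let b := Module.finBasis k X
  refine ⟨Fin (Module.finrank k X) × Fin n,
    LinearMap.pi fun s => LinearMap.proj s.2 ∘ₗ i ∘ₗ toDualModule k (b.coord s.1),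
    fun x y hxy => b.ext_elem fun s => ?_⟩
  have h1 : toDualModule k (A := A) (b.coord s) x = toDualModule k (b.coord s) y :=
    hi (funext fun t => congrFun hxy (s, t))
  have h2 : b.coord s ((1 : A) • x) = b.coord s ((1 : A) • y) :=
    LinearMap.congr_fun (f := DualModule.toLinearMap _) h1 1
  simpa using h2

end FiniteDimensional

/-! ### Restriction along a surjective ring homomorphism -/

section Restriction

variable {A : Type u} {B : Type v} [Ring A] [Ring B] (π : A →+* B)

/-- Restriction of the scalars of a linear map along `π`. -/
def restrictLinear {X Y : Type*} [AddCommGroup X] [AddCommGroup Y] [Module A X] [Module B X]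
    [Module A Y] [Module B Y] (hX : ∀ (a : A) (x : X), a • x = π a • x)
    (hY : ∀ (a : A) (y : Y), a • y = π a • y) (f : X →ₗ[B] Y) : X →ₗ[A] Y where
  toFun := f
  map_add' := map_add f
  map_smul' a x := by simp [hX, hY]

theorem InAdd.restrict {X Z : Type*} [AddCommGroup X] [AddCommGroup Z] [Module A X] [Module B X]
    [Module A Z] [Module B Z] (hX : ∀ (a : A) (x : X), a • x = π a • x)
    (hZ : ∀ (a : A) (z : Z), a • z = π a • z) (h : InAdd B X Z) : InAdd A X Z := by
  obtain ⟨n, i, p, hp⟩ := h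
  have hZ' (a : A) (z : Fin n → Z) : a • z = π a • z := funext fun _ => hZ _ _
  refine ⟨n, restrictLinear π hX hZ' i, restrictLinear π hZ' hX p, ?_⟩
  ext x
  exact LinearMap.congr_fun hp x

variable {π}

theorem exists_module_of_annihilated (hπ : Function.Surjective π) (X : Type w) [AddCommGroup X]
    [Module A X] (h : ∀ a, π a = 0 → ∀ x : X, a • x = 0) :
    ∃ _ : Module B X, ∀ (a : A) (x : X), a • x = π a • x := by
  let l : B →+* AddMonoid.End X := π.liftOfSurjective hπ ⟨Module.toAddMonoidEnd A X, fun a ha =>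
    AddMonoidHom.ext (h a ha)⟩
  refine ⟨Module.compHom X l, fun a x => ?_⟩
  exact (DFunLike.congr_fun (π.liftOfRightInverse_comp_apply _
    (Function.rightInverse_surjInv hπ)
    ⟨Module.toAddMonoidEnd A X, fun a ha => AddMonoidHom.ext (h a ha)⟩ a) x).symm

/-- Extension of the scalars of a linear map along a surjective homomorphism `π`. -/
def extendLinear (hπ : Function.Surjective π) {X Y : Type*} [AddCommGroup X] [AddCommGroup Y]
    [Module A X] [Module B X] [Module A Y] [Module B Y] (hX : ∀ (a : A) (x : X), a • x = π a • x)
    (hY : ∀ (a : A) (y : Y), a • y = π a • y) (f : X →ₗ[A] Y) : X →ₗ[B] Y where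
  toFun := f
  map_add' := map_add f
  map_smul' b x := by
    obtain ⟨a, rfl⟩ := hπ b
    simp [← hX, ← hY]

theorem finite_of_finite_restrict {X : Type w} [AddCommGroup X] [Module A X] [Module B X]
    (hX : ∀ (a : A) (x : X), a • x = π a • x) [Module.Finite A X] (hπ : Function.Surjective π) :
    Module.Finite B X :=
  have : RingHomSurjective π := ⟨hπ⟩
  Module.Finite.of_surjective (σ := π) (M := X)
    { toFun := id, map_add' := fun _ _ => rfl, map_smul' := hX } Function.surjective_id

theorem finite_restrict_of_finite {X : Type w} [AddCommGroup X] [Module A X] [Module B X]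
    (hX : ∀ (a : A) (x : X), a • x = π a • x) [Module.Finite B X] (hπ : Function.Surjective π) :
    Module.Finite A X := by
  let : Module A B := Module.compHom B π
  have : IsScalarTower A B X := ⟨fun a b x => by
    rw [hX, smul_smul]; rfl⟩
  have : Module.Finite A B :=
    Module.Finite.of_surjective (LinearMap.toSpanSingleton A B 1) fun b => by
      obtain ⟨a, rfl⟩ := hπ b
      exact ⟨a, mul_one (π a)⟩
  exact Module.Finite.trans B X

end Restriction

/-! ### Adding an indecomposable projective-injective module -/

section Main

variable {A : Type v} [Ring A]

/-- If the identity of `X` is a sum of a map through `Y` and a map through `W`, then `X` is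
a direct summand of `Y ⊕ W`. -/
theorem InAdd.of_sum {X Y W : Type*} [AddCommGroup X] [Module A X] [AddCommGroup Y] [Module A Y]
    [AddCommGroup W] [Module A W] {Z : Type w} [AddCommGroup Z] [Module A Z]
    (hY : InAdd A Y Z) (hW : InAdd A W Z) (a : X →ₗ[A] Y) (b : Y →ₗ[A] X) (c : X →ₗ[A] W)
    (d : W →ₗ[A] X) (h : b ∘ₗ a + d ∘ₗ c = LinearMap.id) : InAdd A X Z :=
  .of_retract (hY.prod hW) (a.prod c) (b.coprod d) (by rw [← h]; ext x; simp)

theorem PdLT.hom_of_sum {X Y W Z : Type v} [AddCommGroup X] [Module A X] [AddCommGroup Y]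
    [Module A Y] [AddCommGroup W] [Module A W] [AddCommGroup Z] [Module A Z] {n : ℕ}
    (hY : PdLT (Module.End A Z) (Y →ₗ[A] Z) n) (hW : PdLT (Module.End A Z) (W →ₗ[A] Z) n)
    (a : X →ₗ[A] Y) (b : Y →ₗ[A] X) (c : X →ₗ[A] W) (d : W →ₗ[A] X)
    (h : b ∘ₗ a + d ∘ₗ c = LinearMap.id) : PdLT (Module.End A Z) (X →ₗ[A] Z) n := by
  refine (hY.prod hW).of_retract ((precomp Z b).prod (precomp Z d))
    ((precomp Z a).coprod (precomp Z c)) ?_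
  ext f x
  have h1 : b (a x) + d (c x) = x := LinearMap.congr_fun h x
  change f (b (a x)) + f (d (c x)) = f x
  rw [← map_add, h1]

variable {P : Type v} [AddCommGroup P] [Module A P] [IsNoetherian A P] [IsArtinian A P]
  [Module.Injective A P] {B : Type v} [Ring B] {π : A →+* B}
  {Z : Type v} [AddCommGroup Z] [Module A Z] [Module B Z]

theorem inAdd_regular_prod (hP : IsIndecomposable A P) (hπ : Function.Surjective π)
    (hker : ∀ a, π a = 0 → a ∈ socleIdeal A P) [IsArtinianRing A]
    (hZ : ∀ (a : A) (z : Z), a • z = π a • z) (hB : InAdd B B Z) : InAdd A A (Z × P) := by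
  let : Module A B := Module.compHom B π
  have hB' : InAdd A B (Z × P) :=
    (hB.restrict π (fun _ _ => rfl) hZ).trans
      (InAdd.self.of_retract (LinearMap.inl A Z P) (LinearMap.fst A Z P) rfl)
  have hPZ : InAdd A P (Z × P) :=
    InAdd.self.of_retract (LinearMap.inr A Z P) (LinearMap.snd A Z P) rfl
  obtain ⟨e, n, a, b, hab, he⟩ := hP.exists_decomposition A
  let π' : A →ₗ[A] B := LinearMap.toSpanSingleton A B 1
  have hπ' (x : A) : π' x = π x := mul_one (π x)
  -- Since `e x = x • e 1`, the map `e` vanishes on the kernel of `π`, so it factors through `B`.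
  obtain ⟨d, hd⟩ := exists_comp_eq_of_ker_le (g := π') (l := e)
    (fun y => (hπ y).imp fun x hx => (hπ' x).trans hx) fun x hx => by
      rw [LinearMap.mem_ker, hπ'] at hx
      rw [LinearMap.mem_ker, ← mul_one x, ← smul_eq_mul, map_smul, he x (hker x hx)]
  exact .of_sum (hPZ.pi (ι := Fin n)) hB' a b π' d (hd ▸ hab)

theorem inAdd_dualModule_prod {k : Type u} [Field k] [Algebra k A] [Algebra k B] {π : A →ₐ[k] B}
    (hP : IsIndecomposable A P) (hπ : Function.Surjective π)
    (hker : ∀ a, π a = 0 → a ∈ socleIdeal A P) [IsArtinian A (DualModule k A)]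
    (hZ : ∀ (a : A) (z : Z), a • z = π a • z) (hB : InAdd B (DualModule k B) Z) :
    InAdd A (DualModule k A) (Z × P) := by
  let : Module A (DualModule k B) := Module.compHom _ (π : A →+* B)
  have hB' : InAdd A (DualModule k B) (Z × P) :=
    (hB.restrict (π : A →+* B) (fun _ _ => rfl) hZ).trans
      (InAdd.self.of_retract (LinearMap.inl A Z P) (LinearMap.fst A Z P) rfl)
  have hPZ : InAdd A P (Z × P) :=
    InAdd.self.of_retract (LinearMap.inr A Z P) (LinearMap.snd A Z P) rfl
  obtain ⟨e, n, a, b, hab, he⟩ := hP.exists_decomposition (DualModule k A)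
  let i : DualModule k B →ₗ[A] DualModule k A :=
    { toFun := fun f => f.toLinearMap ∘ₗ π.toLinearMap
      map_add' := fun _ _ => rfl
      map_smul' := fun a f => LinearMap.ext fun x =>
        congrArg f.toLinearMap (map_mul π x a).symm }
  have hi : Function.Injective i := fun f g hfg => LinearMap.ext fun y => by
    obtain ⟨x, rfl⟩ := hπ y
    exact LinearMap.congr_fun (f := DualModule.toLinearMap _) hfg x
  -- `B^*` sits in `A^*` as the forms vanishing on the kernel of `π`, and `(e f) x = (x • e f) 1 =
  -- 0` for `x` in that kernel.
  have hrange (f : DualModule k A) : e f ∈ LinearMap.range i := by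
    obtain ⟨g, hg⟩ := exists_comp_eq_of_ker_le (g := π.toLinearMap) (l := (e f).toLinearMap) hπ
      fun x hx => by
        have h1 := LinearMap.congr_fun (f := DualModule.toLinearMap _) (he x (hker x hx) f) 1
        rw [DualModule.smul_apply, one_mul] at h1
        exact h1
    exact ⟨g, hg⟩
  refine .of_sum (hPZ.pi (ι := Fin n)) hB' a b
    ((LinearEquiv.ofInjective i hi).symm.toLinearMap ∘ₗ e.codRestrict _ hrange) i ?_
  rw [← hab]
  congr 1
  ext f
  exact congrArg Subtype.val
    ((LinearEquiv.ofInjective i hi).apply_symm_apply (e.codRestrict _ hrange f))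

theorem pdLT_hom_prod (hP : IsIndecomposable A P) (hπ : Function.Surjective π)
    (hker : ∀ a, π a = 0 → a ∈ socleIdeal A P) [IsNoetherianRing A] [IsArtinianRing A]
    [IsNoetherianRing B] [IsNoetherianRing (Module.End B Z)] [Module.Finite B Z]
    (hZ : ∀ (a : A) (z : Z), a • z = π a • z) (hB : InAdd B B Z) (hZc : Cogenerates B Z)
    (hd : gldim (Module.End B Z) ≤ (1 + 2 : ℕ)) (X : Type v) [AddCommGroup X] [Module A X]
    [Module.Finite A X] : PdLT (Module.End A (Z × P)) (X →ₗ[A] Z × P) 2 := by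
  have hPZ : InAdd A P (Z × P) :=
    InAdd.self.of_retract (LinearMap.inr A Z P) (LinearMap.snd A Z P) rfl
  have hZZ : InAdd A Z (Z × P) :=
    InAdd.self.of_retract (LinearMap.inl A Z P) (LinearMap.fst A Z P) rfl
  obtain ⟨e, n, a, b, hab, he⟩ := hP.exists_decomposition X
  refine .hom_of_sum (Y := Fin n → P) (W := LinearMap.range e) ?_ ?_ a b e.rangeRestrict
    (LinearMap.range e).subtype hab
  · exact (pdLT_one_iff.2 (projective_hom_of_inAdd hPZ.pi)).mono one_le_two
  obtain ⟨_, hX⟩ := exists_module_of_annihilated hπ (LinearMap.range e) fun c hc => by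
    rintro ⟨_, x, rfl⟩
    exact Subtype.ext (he c (hker c hc) x)
  have := finite_of_finite_restrict hX hπ
  obtain ⟨m, W, _, _, f, g, hf, hfi, hg, hfg, hW⟩ :=
    exists_coresolution hB hZc (pdLT_hom_of_gldim_le (X := LinearMap.range e) hd hB)
  let : Module A W := Module.compHom W π
  have hZm (a : A) (z : Fin m → Z) : a • z = π a • z := funext fun _ => hZ _ _
  have hW' (a : A) (w : W) : a • w = π a • w := rfl
  refine pdLT_two_of_coresolution (f := restrictLinear π hX hZm f)
    (g := restrictLinear π hZm hW' g) (fun h => ?_) hg hfg hZZ.pi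
    ((hW.restrict π hW' hZ).trans hZZ)
  -- A map into `Z × P` is extended along `f` componentwise: the `Z`-component is `B`-linear and
  -- uses the approximation over `B`, the `P`-component uses injectivity of `P`.
  obtain ⟨h₁, hh₁⟩ := hf (extendLinear hπ hX hZ (LinearMap.fst A Z P ∘ₗ h))
  obtain ⟨h₂, hh₂⟩ := Module.Injective.extension_property A P _ _ (restrictLinear π hX hZm f) hfi
    (LinearMap.snd A Z P ∘ₗ h)
  refine ⟨(restrictLinear π hZm hZ h₁).prod h₂, LinearMap.ext fun x => Prod.ext ?_ ?_⟩
  · exact LinearMap.congr_fun hh₁ x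
  · exact LinearMap.congr_fun hh₂ x

/-- The infimum of the empty set is `⊤`, so a bound other than `⊤` forces a generator-cogenerator to
exist; the infimum is then attained. -/
theorem exists_of_repdim_le {k : Type u} [Field k] [Algebra k B] {d : WithBot ℕ∞} (hd : d ≠ ⊤)
    (h : repdim k B ≤ d) : ∃ (Z : Type v) (_ : AddCommGroup Z) (_ : Module B Z),
      IsGeneratorCogenerator k B Z ∧ gldim (Module.End B Z) ≤ d := by
  let S := {d | ∃ (Z : Type v) (_ : AddCommGroup Z) (_ : Module B Z),
    IsGeneratorCogenerator k B Z ∧ d = gldim (Module.End B Z)}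
  have hS : S.Nonempty := by
    by_contra hS
    rw [Set.not_nonempty_iff_eq_empty] at hS
    change sInf S ≤ d at h
    rw [hS, sInf_empty] at h
    exact hd (top_le_iff.1 h)
  obtain ⟨Z, _, _, hZ, hd⟩ := csInf_mem hS
  exact ⟨Z, _, _, hZ, hd ▸ h⟩

theorem repdim_le_three_of_surjective {k : Type u} [Field k] [Algebra k A] [FiniteDimensional k A]
    [Algebra k B] {π : A →ₐ[k] B} (hP : IsIndecomposable A P) (hπ : Function.Surjective π)
    (hker : ∀ a, π a = 0 → a ∈ socleIdeal A P) (hB : repdim k B ≤ 3) : repdim k A ≤ 3 := by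
  obtain ⟨Z, _, _, ⟨_, hZ⟩, hd⟩ := exists_of_repdim_le (by decide) hB
  have := Module.Finite.of_surjective π.toLinearMap hπ
  have := isNoetherianRing_of_finiteDimensional k (A := A)
  have := isNoetherianRing_of_finiteDimensional k (A := B)
  have := isArtinianRing_of_finiteDimensional k (A := A)
  have := isArtinian_dualModule k (A := A)
  have := isNoetherianRing_end k (A := B) Z
  let : Module A Z := Module.compHom Z (π : A →+* B)
  have hAZ (a : A) (z : Z) : a • z = (π : A →+* B) a • z := rfl
  have : Module.Finite A Z := finite_restrict_of_finite hAZ hπ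
  have := isNoetherianRing_end k (A := A) (Z × P)
  have hZB : InAdd B B Z :=
    hZ.of_retract (LinearMap.inl B B (DualModule k B)) (LinearMap.fst B B (DualModule k B)) rfl
  have hZD : InAdd B (DualModule k B) Z :=
    hZ.of_retract (LinearMap.inr B B (DualModule k B)) (LinearMap.snd B B (DualModule k B)) rfl
  have hgen : IsGeneratorCogenerator k A (Z × P) := by
    refine ⟨inferInstance, ?_⟩
    exact (inAdd_regular_prod hP hπ hker hAZ hZB).prod (inAdd_dualModule_prod hP hπ hker hAZ hZD)
  -- The bound 3 is written `1 + 2` to match the criterion with `n = 1`: projective dimension at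
  -- most 1 for each `Hom(X, Z × P)`.
  have hgl : gldim (Module.End A (Z × P)) ≤ (1 + 2 : ℕ) := by
    refine gldim_le_of_pdLT_hom fun X _ _ _ => ?_
    exact pdLT_hom_prod hP hπ hker hAZ hZB (cogenerates_of_inAdd_dualModule k hZD) hd X
  exact (sInf_le ⟨Z × P, inferInstance, inferInstance, hgen, rfl⟩ :
    repdim k A ≤ gldim (Module.End A (Z × P))).trans hgl

end Main

end RepDim

theorem proposition1p2 {k : Type u} [Field k] {A : Type v} [Ring A] [Algebra k A]
    (hA : RepDim.IsBasicAlgebra k A)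
    {P : Type v} [AddCommGroup P] [Module A P] [Module.Finite A P]
    [Module.Projective A P] [Module.Injective A P] (hP : RepDim.IsIndecomposable A P)
    (hB : RepDim.repdim k (RepDim.socleIdeal A P).ringCon.Quotient ≤ 3) :
    RepDim.repdim k A ≤ 3 := by
  have := hA.1
  have := RepDim.isNoetherianRing_of_finiteDimensional k (A := A)
  have := RepDim.isArtinianRing_of_finiteDimensional k (A := A)
  refine RepDim.repdim_le_three_of_surjective (π := (RepDim.socleIdeal A P).ringCon.mkₐ k) hP
    (RingCon.mkₐ_surjective _) (fun a ha => ?_) hB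
  exact (RingCon.eq _).1 ha
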